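/- **Setting.** For a (not necessarily unital) C*-algebra $A$ let $\mathfrak S(A)$ be the set of its states (positive functionals of norm one), and for $\omega\in\mathfrak S(A)$ let $\pi_\omega$ be its GNS representation on $\mathcal H_\omega$. For $S\subseteq\mathfrak S(A)$ put $\pi_S=\bigoplus_{\omega\in S}\pi_\omega$ on $\mathcal H_S=\bigoplus_{\omega\in S}\mathcal H_\omega$. The universal representation of $A$ is $\pi_A=\pi_{\mathfrak S(A)}$ on $\mathcal H_A$, and $A''=\pi_A(A)''$ is its universal von Neumann algebra. $M''$ denotes the double commutant and $[\,\cdot\,]$ the closed linear span. Let $\mathcal F$ be a unital C*-algebra and $\mathfrak S_0\subsetneq\mathfrak S(\mathcal F)$ a proper subset of its states. A C*-algebra $\mathcal L$ is an *ideal host* for $(\mathcal F,\mathfrak S_0)$ if there are a unital C*-algebra $\mathcal E\supseteq\mathcal L$ (faithful embedding) and a unital $*$-homomorphism $\xi:\mathcal F\to\mathcal E$ such that $\mathcal L$ is a two-sided ideal of $\mathcal E$ (hence hereditary), $\mathcal E$ is generated as a C*-algebra by $\mathcal L\cup\xi(\mathcal F)$, and the map $\theta:\mathfrak S(\mathcal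 L)\to\mathfrak S(\mathcal F)$, $\theta(\omega)=\hat\omega\circ\xi$, with $\hat\omega$ the unique extension of $\omega$ to a state of $\mathcal E$, is injective with range $\theta(\mathfrak S(\mathcal L))=\mathfrak S_0$. **Theorem.** Let $\mathcal L\subseteq\mathcal E$, with $\xi:\mathcal F\to\mathcal E$, be an ideal host for $(\mathcal F,\mathfrak S_0)$. 1. For every representation $\pi:\mathcal E\to B(\mathcal H)$ on a Hilbert space and every vector $\Omega$ in the essential subspace $[\pi(\mathcal L)\mathcal H]$, $$[\pi(\mathcal L)\Omega]=[\pi(\xi(\mathcal F))\Omega].$$ 2. The universal representation $\pi_{\mathcal L}$ of $\mathcal L$ extends uniquely to a representation $\tilde\pi_{\mathcal L}$ of $\mathcal E$ on the same space $\mathcal H_{\mathcal L}$, and $$\tilde\pi_{\mathcal L}(\xi(\mathcal F))''=\pi_{\mathcal L}(\mathcal L)''=\mathcal L''.$$ 3. There is a unitary $U:\mathcal H_{\mathcal L}\to\mathcal H_{\mathfrak S_0}$ with $U\,\tilde\pi_{\mathcal L}(\xi(F))\,U^*=\pi_{\mathfrak S_0}(F)$ for all $F\in\mathcal F$, and $U\,\mathcal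 L''\,U^*=\pi_{\mathfrak S_0}(\mathcal F)''$. So, up to this identification, every ideal host of $(\mathcal F,\mathfrak S_0)$ has the same universal von Neumann algebra, namely $\pi_{\mathfrak S_0}(\mathcal F)''$. -/

import Mathlib

open scoped ComplexOrder

noncomputable section

namespace HostAlgebra

/-! ### States -/

section States

variable (A : Type*) [NonUnitalCStarAlgebra A] [PartialOrder A]

/-- The state space of a (possibly non-unital) C*-algebra: positive functionals of norm one. -/
def State : Type _ :=
  {ω : StrongDual ℂ A // (∀ a : A, 0 ≤ a → 0 ≤ ω a) ∧ ‖ω‖ = 1}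

variable {A}

instance : CoeFun (State A) (fun _ => A → ℂ) := ⟨fun ω a => ω.1 a⟩

/-- A state, as a bundled positive linear functional. -/
def State.toPositive [StarOrderedRing A] (ω : State A) : A →ₚ[ℂ] ℂ :=
  PositiveLinearMap.mk₀ (ω.1 : A →ₗ[ℂ] ℂ) ω.2.1

end States

/-! ### Hilbert sums of representations -/

section DirectSum

variable {A : Type*} [NonUnitalCStarAlgebra A] {ι : Type*} {H : ι → Type*}
  [∀ i, NormedAddCommGroup (H i)] [∀ i, InnerProductSpace ℂ (H i)] [∀ i, CompleteSpace (H i)]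

lemma memlp_apply (π : ∀ i, A →⋆ₙₐ[ℂ] (H i →L[ℂ] H i)) (a : A) (x : lp H 2) :
    Memℓp (fun i => π i a (x i)) 2 := by
  have h : Memℓp (fun i => (‖a‖ : ℂ) • x i) 2 := (lp.memℓp x).const_smul _
  refine memℓp_gen ((h.summable (by norm_num)).of_nonneg_of_le (fun i => by positivity) ?_)
  intro i
  refine Real.rpow_le_rpow (norm_nonneg _) ?_ (by norm_num)
  calc ‖π i a (x i)‖ ≤ ‖π i a‖ * ‖x i‖ := (π i a).le_opNorm _
    _ ≤ ‖a‖ * ‖x i‖ := by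
        gcongr
        exact NonUnitalStarAlgHom.norm_apply_le (π i) a
    _ = ‖(‖a‖ : ℂ) • x i‖ := by simp [norm_smul]

/-- The operator `⊕ᵢ πᵢ(a)` on the Hilbert sum `⊕ᵢ Hᵢ`. -/
def directSumOp (π : ∀ i, A →⋆ₙₐ[ℂ] (H i →L[ℂ] H i)) (a : A) : lp H 2 →L[ℂ] lp H 2 :=
  LinearMap.mkContinuous
    { toFun := fun x => ⟨fun i => π i a (x i), memlp_apply π a x⟩
      map_add' := fun x y => by ext i; exact map_add (π i a) (x i) (y i)
      map_smul' := fun c x => by ext i; simp } ‖a‖ (by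
    intro x
    have h2 : (0 : ℝ) < (2 : ENNReal).toReal := by norm_num
    have hx : ‖(‖a‖ : ℂ) • x‖ = ‖a‖ * ‖x‖ := by
      rw [norm_smul, Complex.norm_real, norm_norm]
    rw [← hx]
    refine lp.norm_le_of_tsum_le h2 (norm_nonneg _) ?_
    rw [lp.norm_rpow_eq_tsum h2]
    have hs : Summable fun i => ‖((‖a‖ : ℂ) • x) i‖ ^ (2 : ENNReal).toReal :=
      (lp.memℓp ((‖a‖ : ℂ) • x)).summable h2
    refine Summable.tsum_le_tsum ?_ ((memlp_apply π a x).summable h2) hs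
    intro i
    refine Real.rpow_le_rpow (norm_nonneg _) ?_ h2.le
    calc ‖π i a (x i)‖ ≤ ‖π i a‖ * ‖x i‖ := (π i a).le_opNorm _
      _ ≤ ‖a‖ * ‖x i‖ := by
          gcongr
          exact NonUnitalStarAlgHom.norm_apply_le (π i) a
      _ = ‖((‖a‖ : ℂ) • x) i‖ := by
          rw [lp.coeFn_smul, Pi.smul_apply, norm_smul, Complex.norm_real, norm_norm])

@[simp]
lemma directSumOp_apply (π : ∀ i, A →⋆ₙₐ[ℂ] (H i →L[ℂ] H i)) (a : A) (x : lp H 2) (i : ι) :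
    directSumOp π a x i = π i a (x i) := rfl

/-- The Hilbert sum `⊕ᵢ πᵢ` of a family of representations `πᵢ : A → B(Hᵢ)`. -/
def directSumRep (π : ∀ i, A →⋆ₙₐ[ℂ] (H i →L[ℂ] H i)) :
    A →⋆ₙₐ[ℂ] (lp H 2 →L[ℂ] lp H 2) where
  toFun := directSumOp π
  map_smul' c a := by ext x i; simp
  map_zero' := by ext x i; simp
  map_add' a b := by ext x i; simp
  map_mul' a b := by ext x i; simp
  map_star' a := by
    rw [ContinuousLinearMap.star_eq_adjoint, ContinuousLinearMap.eq_adjoint_iff]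
    intro x y
    rw [lp.inner_eq_tsum, lp.inner_eq_tsum]
    refine tsum_congr fun i => ?_
    rw [directSumOp_apply, directSumOp_apply, map_star, ContinuousLinearMap.star_eq_adjoint,
      ContinuousLinearMap.adjoint_inner_left]

@[simp]
lemma directSumRep_apply (π : ∀ i, A →⋆ₙₐ[ℂ] (H i →L[ℂ] H i)) (a : A) (x : lp H 2) (i : ι) :
    directSumRep π a x i = π i a (x i) := rfl

end DirectSum

section Universal

variable {A : Type*} [NonUnitalCStarAlgebra A] [PartialOrder A] [StarOrderedRing A]

/-- The Hilbert space `⊕_{ω ∈ S} H_ω`, where `H_ω` is the GNS space of the state `ω`. -/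
abbrev SumSpace (S : Set (State A)) : Type _ :=
  lp (fun ω : S => (ω.1.toPositive).GNS) 2

/-- The representation `π_S = ⊕_{ω ∈ S} π_ω`, where `π_ω` is the GNS representation of `ω`. -/
def sumRep (S : Set (State A)) : A →⋆ₙₐ[ℂ] (SumSpace S →L[ℂ] SumSpace S) :=
  directSumRep fun ω : S => (ω.1.toPositive).gnsNonUnitalStarAlgHom

variable (A)

/-- The space of the universal representation of `A`. -/
abbrev UniversalSpace : Type _ := SumSpace (Set.univ : Set (State A))

/-- The universal representation of `A`: the sum of the GNS representations of all states. -/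
def universalRep : A →⋆ₙₐ[ℂ] (UniversalSpace A →L[ℂ] UniversalSpace A) :=
  sumRep (Set.univ : Set (State A))

end Universal

/-! ### Closed spans and commutants of sets of operators -/

section Operators

variable {H : Type*} [NormedAddCommGroup H] [InnerProductSpace ℂ H]

/-- The closed linear span `[M Ω]` of the vectors `T Ω`, `T ∈ M`. -/
def cyclicSubspace (M : Set (H →L[ℂ] H)) (Ω : H) : Submodule ℂ H :=
  (Submodule.span ℂ {v | ∃ T ∈ M, v = T Ω}).topologicalClosure

/-- The essential subspace `[M H]`, the closed linear span of the vectors `T v`, `T ∈ M`,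
`v ∈ H`. -/
def essentialSubspace (M : Set (H →L[ℂ] H)) : Submodule ℂ H :=
  (Submodule.span ℂ {w | ∃ T ∈ M, ∃ v : H, w = T v}).topologicalClosure

/-- The double commutant `M''` in `B(H)`. -/
def doubleCommutant (M : Set (H →L[ℂ] H)) : Set (H →L[ℂ] H) :=
  Set.centralizer (Set.centralizer M)

end Operators

/-! ### Host algebras -/

section Host

variable {F E L : Type*}
  [CStarAlgebra F] [PartialOrder F]
  [CStarAlgebra E] [PartialOrder E]
  [NonUnitalCStarAlgebra L] [PartialOrder L]

/-- The graph of the extension map `θ : 𝔖(L) → 𝔖(F)`: `θ(ω) = φ` means that `φ = ψ ∘ ξ` for the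
extension `ψ` of `ω` from `L` to a state of `E`. (The extension exists, and it is unique when `L`
is hereditary in `E`.) -/
def IsTheta (ι : L →⋆ₙₐ[ℂ] E) (ξ : F →⋆ₐ[ℂ] E) (ω : State L) (φ : State F) : Prop :=
  ∃ ψ : State E, (∀ l : L, ψ (ι l) = ω l) ∧ ∀ f : F, φ f = ψ (ξ f)

/-- `L`, embedded in the unital C*-algebra `E` by `ι`, is a host for the pair `(F, S₀)`, where `F`
is mapped to `E` by the unital *-homomorphism `ξ`. -/
structure IsHost (S₀ : Set (State F)) (ι : L →⋆ₙₐ[ℂ] E) (ξ : F →⋆ₐ[ℂ] E) : Prop where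
  /-- `S₀` is a proper subset of the state space of `F` -/
  proper : S₀ ≠ Set.univ
  /-- `L` is faithfully embedded in `E` -/
  injective : Function.Injective ι
  /-- `L` is hereditary in `E` -/
  hereditary : ∀ (a : E) (b : L), 0 ≤ a → a ≤ ι b → a ∈ Set.range ι
  /-- `E` is generated, as a C*-algebra, by `L` and `ξ(F)` -/
  generated : (StarAlgebra.adjoin ℂ (Set.range ι ∪ Set.range ξ)).topologicalClosure = ⊤
  /-- `θ` is injective -/
  theta_injective : ∀ (ω₁ ω₂ : State L) (φ : State F),
    IsTheta ι ξ ω₁ φ → IsTheta ι ξ ω₂ φ → ω₁ = ω₂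
  /-- the range of `θ` is `S₀` -/
  theta_range : ∀ φ : State F, φ ∈ S₀ ↔ ∃ ω : State L, IsTheta ι ξ ω φ

/-- An ideal host: a host that is a two-sided ideal of `E`. -/
structure IsIdealHost (S₀ : Set (State F)) (ι : L →⋆ₙₐ[ℂ] E) (ξ : F →⋆ₐ[ℂ] E) : Prop
    extends IsHost S₀ ι ξ where
  mul_left_mem : ∀ (e : E) (l : L), e * ι l ∈ Set.range ι
  mul_right_mem : ∀ (e : E) (l : L), ι l * e ∈ Set.range ι

end Host

end HostAlgebra

end

open HostAlgebra

/-! Everything rests on the injectivity of `θ`, used through polarization. Let `Ω` lie in the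
essential subspace of `L`. An approximate unit `u` of `L` gives `π(a)Ω = lim π(au)Ω` with `au ∈ L`,
so `[π(F)Ω] ⊆ [π(L)Ω]`. Conversely, let `v ∈ [π(L)Ω]` be orthogonal to `[π(F)Ω]`. For unimodular `c`
the vector functional of `Ω + cv` on `F` has no cross terms, so it does not depend on `c`.
Injectivity of `θ` then makes its restriction to `L` independent of `c`, so the cross terms `⟪v,
π(l)Ω⟫` vanish as well. Thus `v ⊥ [π(L)Ω]`, and `v = 0` (`IsIdealHost.cyclicSubspace_eq`).

Applied to `π ⊕ π`, this equality yields equal commutants: an operator commutes with an algebra when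
its graph is invariant, and the cyclic subspace of `(v, Tv)` detects this
(`centralizer_subset_of_cyclicSubspace_le`, `IsIdealHost.centralizer_eq`). No density theorem is
needed.

The GNS representation of a state `ω` of the ideal `L` extends to `E` by `e[a] = [ea]`. Its cyclic
vector is cyclic for `L`, hence for `F`, and implements `θ(ω)` on `F`. By uniqueness of GNS the
restriction to `F` is therefore `π_{θ(ω)}` (`IsIdealHost.exists_unitary_theta`). Since `θ` is a
bijection onto `S₀`, summing over states identifies the extended universal representation,
restricted to `F`, with `π_{S₀}`. -/

noncomputable section

namespace HostAlgebra

open Filter Topology CStarAlgebra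

/-! ### Approximate units and vector states in a representation -/

section Nondegenerate

variable {A : Type*} [NonUnitalCStarAlgebra A] {H : Type*} [NormedAddCommGroup H]
  [InnerProductSpace ℂ H] [CompleteSpace H]

lemma norm_rep_apply_le (π : A →⋆ₙₐ[ℂ] (H →L[ℂ] H)) (a : A) (v : H) :
    ‖π a v‖ ≤ ‖a‖ * ‖v‖ :=
  ((π a).le_opNorm v).trans
    (mul_le_mul_of_nonneg_right (NonUnitalStarAlgHom.norm_apply_le π a) (norm_nonneg v))

lemma continuous_rep_apply (π : A →⋆ₙₐ[ℂ] (H →L[ℂ] H)) (v : H) :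
    Continuous fun a => π a v := by
  have hc : Continuous π :=
    AddMonoidHomClass.continuous_of_bound π 1 fun a => by
      simpa using NonUnitalStarAlgHom.norm_apply_le π a
  exact hc.clm_apply continuous_const

lemma inner_rep_left (π : A →⋆ₙₐ[ℂ] (H →L[ℂ] H)) (a : A) (v w : H) :
    inner ℂ (π a v) w = inner ℂ v (π (star a) w) := by
  rw [map_star, ContinuousLinearMap.star_eq_adjoint, ContinuousLinearMap.adjoint_inner_right]

/-- The functional `a ↦ ⟪w, π(a) w⟫`. -/
def vectorFunctional (π : A →⋆ₙₐ[ℂ] (H →L[ℂ] H)) (w : H) : StrongDual ℂ A :=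
  LinearMap.mkContinuous
    { toFun := fun a => inner ℂ w (π a w)
      map_add' := fun a b => by simp
      map_smul' := fun c a => by simp } (‖w‖ ^ 2) (by
    intro a
    refine (norm_inner_le_norm _ _).trans ?_
    calc ‖w‖ * ‖π a w‖ ≤ ‖w‖ * (‖a‖ * ‖w‖) := by gcongr; exact norm_rep_apply_le π a w
      _ = ‖w‖ ^ 2 * ‖a‖ := by ring)

@[simp]
lemma vectorFunctional_apply (π : A →⋆ₙₐ[ℂ] (H →L[ℂ] H)) (w : H) (a : A) :
    vectorFunctional π w a = inner ℂ w (π a w) := rfl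

variable [PartialOrder A] [StarOrderedRing A]

/-- An approximate unit converges strongly to the identity on the essential subspace. -/
lemma tendsto_approximateUnit_apply (π : A →⋆ₙₐ[ℂ] (H →L[ℂ] H)) {w : H}
    (hw : w ∈ essentialSubspace (Set.range π)) :
    Tendsto (fun e => π e w) (approximateUnit A) (𝓝 w) := by
  have hspan : ∀ x ∈ Submodule.span ℂ {w : H | ∃ T ∈ Set.range π, ∃ v : H, w = T v},
      Tendsto (fun e => π e x) (approximateUnit A) (𝓝 x) := by
    intro x hx
    induction hx using Submodule.span_induction with
    | mem x h =>
      obtain ⟨_, ⟨a, rfl⟩, v, rfl⟩ := h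
      have := ((continuous_rep_apply π v).tendsto a).comp
        ((increasingApproximateUnit A).tendsto_mul_right a)
      simpa [Function.comp_def] using this
    | zero => simp
    | add x y _ _ hx hy => simpa using hx.add hy
    | smul c x _ hx => simpa using hx.const_smul c
  rw [Metric.tendsto_nhds]
  intro ε hε
  obtain ⟨x, hx, hxw⟩ := Metric.mem_closure_iff.1 hw (ε / 3) (by positivity)
  filter_upwards [Metric.tendsto_nhds.1 (hspan x hx) (ε / 3) (by positivity),
    (increasingApproximateUnit A).eventually_norm] with e he hn
  have h1 : ‖π e (w - x)‖ ≤ ‖w - x‖ :=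
    (norm_rep_apply_le π e _).trans (by nlinarith [norm_nonneg (w - x)])
  rw [map_sub] at h1
  rw [dist_eq_norm] at *
  calc ‖π e w - w‖ = ‖(π e w - π e x) + (π e x - x) - (w - x)‖ := by congr 1; abel
    _ ≤ ‖π e w - π e x‖ + ‖π e x - x‖ + ‖w - x‖ :=
        (norm_sub_le _ _).trans (by gcongr; exact norm_add_le _ _)
    _ < ε := by linarith

/-- The vector state of a unit vector in the essential subspace of a representation. -/
def vectorState (π : A →⋆ₙₐ[ℂ] (H →L[ℂ] H)) (w : H)
    (hw : w ∈ essentialSubspace (Set.range π)) (h1 : ‖w‖ = 1) : State A :=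
  ⟨vectorFunctional π w, by
    intro a ha
    obtain ⟨b, rfl⟩ := CStarAlgebra.nonneg_iff_eq_star_mul_self.1 ha
    rw [vectorFunctional_apply, map_mul, mul_apply_eq_comp, ← inner_rep_left]
    have h : (inner ℂ (π b w) (π b w) : ℂ) = ((‖π b w‖ ^ 2 : ℝ) : ℂ) := by
      rw [inner_self_eq_norm_sq_to_K]; simp
    rw [h]
    exact Complex.zero_le_real.2 (sq_nonneg _), by
    refine le_antisymm ((LinearMap.mkContinuous_norm_le _ (by positivity) _).trans
      (by rw [h1, one_pow])) ?_
    have := (increasingApproximateUnit A).neBot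
    -- The norm is attained in the limit along the approximate unit: `⟪w, π(e)w⟫ → ‖w‖² = 1`.
    have ht : Tendsto (fun e => ‖vectorFunctional π w e‖) (approximateUnit A) (𝓝 1) := by
      have := (tendsto_const_nhds (x := w)).inner (𝕜 := ℂ) (tendsto_approximateUnit_apply π hw)
      simpa [h1] using this.norm
    refine le_of_tendsto ht ?_
    filter_upwards [(increasingApproximateUnit A).eventually_norm] with e he
    exact ((vectorFunctional π w).le_opNorm e).trans
      (mul_le_of_le_one_right (norm_nonneg _) he)⟩

@[simp]
lemma vectorState_apply (π : A →⋆ₙₐ[ℂ] (H →L[ℂ] H)) (w : H)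
    (hw : w ∈ essentialSubspace (Set.range π)) (h1 : ‖w‖ = 1) (a : A) :
    vectorState π w hw h1 a = inner ℂ w (π a w) := rfl

end Nondegenerate

/-! ### Closed spans -/

section Subspaces

variable {H : Type*} [NormedAddCommGroup H] [InnerProductSpace ℂ H]

lemma apply_mem_essentialSubspace {M : Set (H →L[ℂ] H)} {T : H →L[ℂ] H} (hT : T ∈ M) (v : H) :
    T v ∈ essentialSubspace M :=
  Submodule.le_topologicalClosure _ (Submodule.subset_span ⟨T, hT, v, rfl⟩)

lemma essentialSubspace_mono {M N : Set (H →L[ℂ] H)} (h : M ⊆ N) :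
    essentialSubspace M ≤ essentialSubspace N :=
  Submodule.topologicalClosure_mono
    (Submodule.span_mono fun _ ⟨T, hT, v, hv⟩ => ⟨T, h hT, v, hv⟩)

lemma apply_mem_cyclicSubspace {M : Set (H →L[ℂ] H)} {T : H →L[ℂ] H} (hT : T ∈ M) (v : H) :
    T v ∈ cyclicSubspace M v :=
  Submodule.le_topologicalClosure _ (Submodule.subset_span ⟨T, hT, rfl⟩)

lemma isClosed_cyclicSubspace (M : Set (H →L[ℂ] H)) (v : H) :
    IsClosed (cyclicSubspace M v : Set H) :=
  Submodule.isClosed_topologicalClosure _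

lemma cyclicSubspace_le {M : Set (H →L[ℂ] H)} {v : H} {K : Submodule ℂ H}
    (hK : IsClosed (K : Set H)) (h : ∀ T ∈ M, T v ∈ K) : cyclicSubspace M v ≤ K :=
  Submodule.topologicalClosure_minimal _
    (Submodule.span_le.2 (by rintro _ ⟨T, hT, rfl⟩; exact h T hT)) hK

lemma cyclicSubspace_le_essentialSubspace (M : Set (H →L[ℂ] H)) (v : H) :
    cyclicSubspace M v ≤ essentialSubspace M :=
  cyclicSubspace_le (Submodule.isClosed_topologicalClosure _)
    fun _ hT => apply_mem_essentialSubspace hT v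

end Subspaces

/-! ### Equality of the cyclic subspaces of `L` and `F` -/

section Host

variable {F : Type*} [CStarAlgebra F] {E : Type*} [CStarAlgebra E]
  {L : Type*} [NonUnitalCStarAlgebra L] {ι : L →⋆ₙₐ[ℂ] E}
  {H : Type*} [NormedAddCommGroup H] [InnerProductSpace ℂ H] [CompleteSpace H]

/-- The identity of `E` acts as the identity on the essential subspace of `E`. -/
lemma rep_one_apply (π : E →⋆ₙₐ[ℂ] (H →L[ℂ] H)) {w : H}
    (hw : w ∈ essentialSubspace (Set.range π)) : π 1 w = w := by
  have : essentialSubspace (Set.range π) ≤ LinearMap.eqLocus (π 1 : H →ₗ[ℂ] H) LinearMap.id := by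
    refine Submodule.topologicalClosure_minimal _ (Submodule.span_le.2 ?_)
      (isClosed_eq (π 1).continuous continuous_id)
    rintro _ ⟨_, ⟨a, rfl⟩, v, rfl⟩
    change π 1 (π a v) = π a v
    rw [← mul_apply_eq_comp, ← map_mul, one_mul]
  exact this hw

lemma mem_essentialSubspace_of_ideal (π : E →⋆ₙₐ[ℂ] (H →L[ℂ] H)) {w : H}
    (hw : w ∈ essentialSubspace (Set.range fun l : L => π (ι l))) :
    w ∈ essentialSubspace (Set.range π) :=
  essentialSubspace_mono (by rintro _ ⟨l, rfl⟩; exact ⟨ι l, rfl⟩) hw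

/-- Representations of `E` need not be unital, but `π(ξ(1)) = π(1)` fixes every `w` in the essential
subspace of `E`. -/
lemma mem_essentialSubspace_comp (π : E →⋆ₙₐ[ℂ] (H →L[ℂ] H)) (ξ : F →⋆ₐ[ℂ] E) {w : H}
    (hw : w ∈ essentialSubspace (Set.range π)) :
    w ∈ essentialSubspace (Set.range (π.comp ξ.toNonUnitalStarAlgHom)) := by
  have h := apply_mem_essentialSubspace
    (Set.mem_range_self (f := π.comp ξ.toNonUnitalStarAlgHom) (1 : F)) w
  have h1 : (π.comp ξ.toNonUnitalStarAlgHom) 1 w = w := by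
    change π (ξ 1) w = w
    rw [map_one, rep_one_apply π hw]
  rwa [h1] at h

variable [PartialOrder L] [StarOrderedRing L]

lemma rep_mul_ideal_tendsto (π : E →⋆ₙₐ[ℂ] (H →L[ℂ] H)) {w : H}
    (hw : w ∈ essentialSubspace (Set.range fun l : L => π (ι l))) (a : E) :
    Tendsto (fun e : L => π (a * ι e) w) (approximateUnit L) (𝓝 (π a w)) := by
  have := ((π a).continuous.tendsto w).comp (tendsto_approximateUnit_apply (π.comp ι) hw)
  refine this.congr fun e => ?_
  simp

/-- The cyclic subspace of `L` is invariant under the enveloping algebra `E`. -/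
lemma rep_apply_mem_cyclicSubspace (hl : ∀ (e : E) (l : L), e * ι l ∈ Set.range ι)
    (π : E →⋆ₙₐ[ℂ] (H →L[ℂ] H)) {w : H}
    (hw : w ∈ essentialSubspace (Set.range fun l : L => π (ι l))) (a : E) :
    π a w ∈ cyclicSubspace (Set.range fun l : L => π (ι l)) w := by
  have := (increasingApproximateUnit L).neBot
  refine (isClosed_cyclicSubspace _ w).mem_of_tendsto (rep_mul_ideal_tendsto π hw a)
    (Eventually.of_forall fun e => ?_)
  obtain ⟨l, hl⟩ := hl a e
  rw [← hl]
  exact apply_mem_cyclicSubspace (Set.mem_range_self (f := fun l : L => π (ι l)) l) w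

variable [PartialOrder F] [StarOrderedRing F] [PartialOrder E] [StarOrderedRing E]
  {S₀ : Set (State F)} {ξ : F →⋆ₐ[ℂ] E}

/-- The restriction to `L` of the vector state of a unit vector is mapped by `θ` to its
restriction to `F`. -/
lemma isTheta_vectorState (π : E →⋆ₙₐ[ℂ] (H →L[ℂ] H)) {w : H}
    (hw : w ∈ essentialSubspace (Set.range (π.comp ι))) (h1 : ‖w‖ = 1)
    (hE : w ∈ essentialSubspace (Set.range π)) :
    IsTheta ι ξ (vectorState (π.comp ι) w hw h1)
      (vectorState (π.comp ξ.toNonUnitalStarAlgHom) w (mem_essentialSubspace_comp π ξ hE) h1) :=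
  ⟨vectorState π w hE h1, fun _ => rfl, fun _ => rfl⟩

/-- Vector functionals of a host that agree on `F` agree on `L`. -/
lemma IsHost.inner_eq_of_inner_eq (hL : IsHost S₀ ι ξ) (π : E →⋆ₙₐ[ℂ] (H →L[ℂ] H)) {x y : H}
    (hx : x ∈ essentialSubspace (Set.range fun l : L => π (ι l)))
    (hy : y ∈ essentialSubspace (Set.range fun l : L => π (ι l)))
    (h : ∀ f : F, inner ℂ x (π (ξ f) x) = inner ℂ y (π (ξ f) y)) (l : L) :
    inner ℂ x (π (ι l) x) = inner ℂ y (π (ι l) y) := by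
  have hxE := mem_essentialSubspace_of_ideal π hx
  have hyE := mem_essentialSubspace_of_ideal π hy
  -- Taking `f = 1` compares norms, so a common factor `c` normalizes both vectors and injectivity
  -- of `θ`, a statement about states, becomes applicable.
  have hn : ‖x‖ = ‖y‖ := by
    have := h 1
    rw [map_one, rep_one_apply π hxE, rep_one_apply π hyE, inner_self_eq_norm_sq_to_K,
      inner_self_eq_norm_sq_to_K] at this
    exact (sq_eq_sq₀ (norm_nonneg _) (norm_nonneg _)).1 (by exact_mod_cast this)
  by_cases hx0 : x = 0
  · have hy0 : y = 0 := by rw [← norm_eq_zero, ← hn, hx0, norm_zero]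
    simp [hx0, hy0]
  set c : ℂ := ((‖x‖⁻¹ : ℝ) : ℂ) with hc
  have hxn : ‖x‖ ≠ 0 := norm_ne_zero_iff.2 hx0
  have hc0 : c ≠ 0 := by rw [hc]; exact_mod_cast inv_ne_zero hxn
  have hx1 : ‖c • x‖ = 1 := by
    rw [norm_smul, hc, Complex.norm_real, norm_inv, norm_norm, inv_mul_cancel₀ hxn]
  have hy1 : ‖c • y‖ = 1 := by rw [norm_smul, ← hn, ← norm_smul, hx1]
  have hcx : c • x ∈ essentialSubspace (Set.range (π.comp ι)) := Submodule.smul_mem _ c hx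
  have hcy : c • y ∈ essentialSubspace (Set.range (π.comp ι)) := Submodule.smul_mem _ c hy
  have hφ : vectorState (π.comp ξ.toNonUnitalStarAlgHom) (c • x)
        (mem_essentialSubspace_comp π ξ (Submodule.smul_mem _ c hxE)) hx1 =
      vectorState (π.comp ξ.toNonUnitalStarAlgHom) (c • y)
        (mem_essentialSubspace_comp π ξ (Submodule.smul_mem _ c hyE)) hy1 := by
    refine Subtype.ext (ContinuousLinearMap.ext fun f => ?_)
    change inner ℂ (c • x) (π (ξ f) (c • x)) = inner ℂ (c • y) (π (ξ f) (c • y))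
    simp only [map_smul, inner_smul_left, inner_smul_right, h f]
  have hω := hL.theta_injective _ _ _
    (isTheta_vectorState (ξ := ξ) π hcx hx1 (Submodule.smul_mem _ c hxE))
    (hφ ▸ isTheta_vectorState (ξ := ξ) π hcy hy1 (Submodule.smul_mem _ c hyE))
  have hl : inner ℂ (c • x) (π (ι l) (c • x)) = inner ℂ (c • y) (π (ι l) (c • y)) :=
    congrArg (fun ω : State L => ω l) hω
  simp only [map_smul, inner_smul_left, inner_smul_right] at hl
  exact mul_left_cancel₀ (by simpa using hc0) (mul_left_cancel₀ hc0 hl)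

/-- `[π(L)Ω] = [π(F)Ω]` for `Ω` in the essential subspace. -/
theorem IsIdealHost.cyclicSubspace_eq (hL : IsIdealHost S₀ ι ξ) (π : E →⋆ₙₐ[ℂ] (H →L[ℂ] H))
    {Ω : H} (hΩ : Ω ∈ essentialSubspace (Set.range fun l : L => π (ι l))) :
    cyclicSubspace (Set.range fun l : L => π (ι l)) Ω =
      cyclicSubspace (Set.range fun f : F => π (ξ f)) Ω := by
  set K := cyclicSubspace (Set.range fun l : L => π (ι l)) Ω with hK
  set K₁ := cyclicSubspace (Set.range fun f : F => π (ξ f)) Ω with hK₁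
  have hle : K₁ ≤ K := cyclicSubspace_le (isClosed_cyclicSubspace _ _) (by
    rintro _ ⟨f, rfl⟩
    exact rep_apply_mem_cyclicSubspace hL.mul_left_mem π hΩ _)
  refine le_antisymm (fun k hk => ?_) hle
  have : CompleteSpace K₁ := (isClosed_cyclicSubspace _ _).completeSpace_coe
  set v := k - K₁.starProjection k with hv
  have hPk : K₁.starProjection k ∈ K₁ := Submodule.starProjection_apply_mem _ _
  have hvK : v ∈ K := K.sub_mem hk (hle hPk)
  have hv₁ : v ∈ K₁ᗮ := Submodule.sub_starProjection_mem_orthogonal k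
  have hve := cyclicSubspace_le_essentialSubspace _ _ hvK
  have hF₁ : ∀ f : F, inner ℂ v (π (ξ f) Ω) = 0 := fun f =>
    Submodule.inner_left_of_mem_orthogonal (apply_mem_cyclicSubspace
      (Set.mem_range_self (f := fun f : F => π (ξ f)) f) Ω) hv₁
  have hF₂ : ∀ f : F, inner ℂ Ω (π (ξ f) v) = 0 := fun f => by
    rw [← inner_conj_symm, inner_rep_left, ← map_star, hF₁, map_zero]
  -- The functionals of `Ω + v` and `Ω + c • v` agree on `F` because the cross terms vanish there
  -- and `|c| = 1`; hence they agree on `L`.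
  have key : ∀ c : ℂ, (starRingEnd ℂ) c * c = 1 → ∀ l : L,
      inner ℂ Ω (π (ι l) v) + inner ℂ v (π (ι l) Ω) =
        c * inner ℂ Ω (π (ι l) v) + (starRingEnd ℂ) c * inner ℂ v (π (ι l) Ω) := by
    intro c hc l
    have := hL.toIsHost.inner_eq_of_inner_eq π (Submodule.add_mem _ hΩ hve)
      (Submodule.add_mem _ hΩ (Submodule.smul_mem _ c hve)) (fun f => by
        simp only [map_add, map_smul, inner_add_left, inner_add_right, inner_smul_left,
          inner_smul_right, hF₁, hF₂]
        linear_combination (-(inner ℂ v (π (ξ f) v) : ℂ)) * hc) l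
    simp only [map_add, map_smul, inner_add_left, inner_add_right, inner_smul_left,
      inner_smul_right] at this
    linear_combination this + (inner ℂ v (π (ι l) v) : ℂ) * hc
  have hvl : ∀ l : L, inner ℂ v (π (ι l) Ω) = 0 := by
    intro l
    -- With `a = ⟪Ω, π(l)v⟫` and `b = ⟪v, π(l)Ω⟫`, the choice `c = -1` gives `a + b = 0`, and `c =
    -- i` then gives `a - b = 0`.
    have h₁ := key (-1) (by simp) l
    have h₂ := key Complex.I (by simp) l
    simp only [map_neg, map_one, Complex.conj_I] at h₁ h₂
    have h₃ : Complex.I * inner ℂ v (π (ι l) Ω) = 0 := by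
      linear_combination (Complex.I / 4 - 1 / 4) * h₁ + h₂ / 2
    exact (mul_eq_zero.1 h₃).resolve_left Complex.I_ne_zero
  have hKv : K ≤ (ℂ ∙ v)ᗮ := cyclicSubspace_le (Submodule.isClosed_orthogonal _) (by
    rintro _ ⟨l, rfl⟩
    exact Submodule.mem_orthogonal_singleton_iff_inner_right.2 (hvl l))
  have hv0 : v = 0 := inner_self_eq_zero.1
    (Submodule.mem_orthogonal_singleton_iff_inner_right.1 (hKv hvK))
  rw [sub_eq_zero.1 hv0]
  exact hPk

end Host

/-! ### The action of `E` on an ideal by left multiplication -/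

section Ideal

variable {E : Type*} [CStarAlgebra E] {L : Type*} [NonUnitalCStarAlgebra L] {ι : L →⋆ₙₐ[ℂ] E}
  (hι : Function.Injective ι) (hl : ∀ (e : E) (l : L), e * ι l ∈ Set.range ι)

/-- Left multiplication of a left ideal `L` by elements of the ambient algebra `E`. -/
def idealMul (e : E) : L →ₗ[ℂ] L where
  toFun l := (hl e l).choose
  map_add' a b := hι ((hl e (a + b)).choose_spec.trans
    ((by rw [map_add, mul_add] : e * ι (a + b) = e * ι a + e * ι b).trans
      ((congrArg₂ (· + ·) (hl e a).choose_spec (hl e b).choose_spec).symm.trans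
        (map_add ι _ _).symm)))
  map_smul' c a := hι ((hl e (c • a)).choose_spec.trans
    ((by rw [map_smul, mul_smul_comm] : e * ι (c • a) = c • (e * ι a)).trans
      ((congrArg (c • ·) (hl e a).choose_spec).symm.trans (map_smul ι _ _).symm)))

lemma map_idealMul (e : E) (l : L) : ι (idealMul hι hl e l) = e * ι l := (hl e l).choose_spec

lemma idealMul_mul (e : E) (a b : L) : idealMul hι hl e (a * b) = idealMul hι hl e a * b :=
  hι (by simp only [map_idealMul, map_mul, mul_assoc])

lemma idealMul_map (a b : L) : idealMul hι hl (ι a) b = a * b :=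
  hι (by simp only [map_idealMul, map_mul])

lemma add_idealMul (e e' : E) (a : L) :
    idealMul hι hl (e + e') a = idealMul hι hl e a + idealMul hι hl e' a :=
  hι (by simp only [map_idealMul, map_add, add_mul])

lemma smul_idealMul (c : ℂ) (e : E) (a : L) :
    idealMul hι hl (c • e) a = c • idealMul hι hl e a :=
  hι (by simp only [map_idealMul, map_smul, smul_mul_assoc])

lemma mul_idealMul (e e' : E) (a : L) :
    idealMul hι hl (e * e') a = idealMul hι hl e (idealMul hι hl e' a) :=
  hι (by simp only [map_idealMul, mul_assoc])

/-- On GNS spaces this says that the operator of `star e` is the adjoint of the operator of `e`. -/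
lemma star_idealMul_mul (e : E) (a b : L) :
    star (idealMul hι hl e a) * b = star a * idealMul hι hl (star e) b :=
  hι (by simp only [map_idealMul, map_mul, map_star, star_mul, mul_assoc])

/-- An injective *-homomorphism of C*-algebras is isometric, so the bound can be read off in `E`. -/
lemma norm_idealMul_le (e : E) (a : L) : ‖idealMul hι hl e a‖ ≤ ‖e‖ * ‖a‖ := by
  rw [← NonUnitalStarAlgHom.norm_map ι hι, map_idealMul, ← NonUnitalStarAlgHom.norm_map ι hι a]
  exact norm_mul_le _ _

lemma continuous_idealMul (e : E) : Continuous (idealMul hι hl e) :=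
  AddMonoidHomClass.continuous_of_bound _ ‖e‖ (norm_idealMul_le hι hl e)

end Ideal

/-! ### Extending GNS representations from an ideal -/

section GNS

open UniformSpace PositiveLinearMap

variable {L : Type*} [NonUnitalCStarAlgebra L] [PartialOrder L] [StarOrderedRing L]
  (f : L →ₚ[ℂ] ℂ)

lemma continuous_toPreGNS : Continuous f.toPreGNS := by
  obtain ⟨C, hC⟩ := f.exists_norm_apply_le
  refine AddMonoidHomClass.continuous_of_bound f.toPreGNS (√C) fun a => ?_
  rw [preGNS_norm_def, ofPreGNS_toPreGNS, ← Real.sqrt_sq (norm_nonneg a),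
    ← Real.sqrt_mul C.coe_nonneg]
  refine Real.sqrt_le_sqrt ((Complex.re_le_norm _).trans ((hC _).trans ?_))
  rw [CStarRing.norm_star_mul_self, sq]

lemma continuous_coe_toPreGNS : Continuous fun a : L => (f.toPreGNS a : f.GNS) :=
  (Completion.continuous_coe _).comp (continuous_toPreGNS f)

lemma inner_coe_toPreGNS (a b : L) :
    inner ℂ (f.toPreGNS a : f.GNS) (f.toPreGNS b : f.GNS) = f (star a * b) := by
  rw [Completion.inner_coe, preGNS_inner_def, ofPreGNS_toPreGNS, ofPreGNS_toPreGNS]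

lemma gns_coe_toPreGNS (a b : L) :
    f.gnsNonUnitalStarAlgHom a (f.toPreGNS b : f.GNS) = (f.toPreGNS (a * b) : f.GNS) := by
  rw [gnsNonUnitalStarAlgHom_apply_coe]
  rfl

lemma denseRange_coe_toPreGNS : DenseRange fun a : L => (f.toPreGNS a : f.GNS) :=
  Completion.denseRange_coe.comp f.toPreGNS.surjective.denseRange (Completion.continuous_coe _)

/-- A vector annihilated by the GNS representation vanishes. -/
lemma eq_zero_of_gns_apply_eq_zero {x : f.GNS} (hx : ∀ a : L, f.gnsNonUnitalStarAlgHom a x = 0) :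
    x = 0 := by
  have := (increasingApproximateUnit L).neBot
  refine (denseRange_coe_toPreGNS f).eq_zero_of_inner_left ℂ ?_
  rintro a
  -- A vector killed by every `π(e*)` is orthogonal to every `[ea]`, and `ea → a` along the
  -- approximate unit.
  have h0 : ∀ e : L, inner ℂ x (f.toPreGNS (e * a) : f.GNS) = (0 : ℂ) := fun e => by
    rw [← gns_coe_toPreGNS, ← star_star e, ← inner_rep_left, hx, inner_zero_left]
  have ht := ((continuous_const (y := x)).inner (𝕜 := ℂ) (continuous_coe_toPreGNS f)).tendsto a
    |>.comp ((increasingApproximateUnit L).tendsto_mul_right a)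
  exact tendsto_nhds_unique (ht.congr h0) tendsto_const_nhds

variable {E : Type*} [CStarAlgebra E] {ι : L →⋆ₙₐ[ℂ] E}
  (hι : Function.Injective ι) (hl : ∀ (e : E) (l : L), e * ι l ∈ Set.range ι)

/-- Replacing `a` by `ua` turns left multiplication by `e` into left multiplication by `eu ∈ L`,
whose norm is at most `‖e‖`; the bound survives the limit `ua → a`. -/
lemma norm_toPreGNS_idealMul_le (e : E) (a : L) :
    ‖f.toPreGNS (idealMul hι hl e a)‖ ≤ ‖e‖ * ‖f.toPreGNS a‖ := by
  have := (increasingApproximateUnit L).neBot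
  have ht : Tendsto (fun u => ‖f.toPreGNS (idealMul hι hl e (u * a))‖) (approximateUnit L)
      (𝓝 ‖f.toPreGNS (idealMul hι hl e a)‖) :=
    (((continuous_toPreGNS f).comp (continuous_idealMul hι hl e)).norm.tendsto a).comp
      ((increasingApproximateUnit L).tendsto_mul_right a)
  refine le_of_tendsto ht ?_
  filter_upwards [(increasingApproximateUnit L).eventually_norm] with u hu
  rw [idealMul_mul]
  have h1 : ‖f.leftMulMapPreGNS (idealMul hι hl e u) (f.toPreGNS a)‖ ≤
      ‖idealMul hι hl e u‖ * ‖f.toPreGNS a‖ :=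
    ContinuousLinearMap.le_of_opNorm_le _
      (LinearMap.mkContinuous_norm_le _ (norm_nonneg _) _) _
  refine h1.trans ?_
  gcongr
  exact (norm_idealMul_le hι hl e u).trans (mul_le_of_le_one_right (norm_nonneg _) hu)

/-- The operator `[a] ↦ [e a]` on the pre-GNS space of a functional on an ideal. -/
def preGNSIdealMul (e : E) : f.PreGNS →L[ℂ] f.PreGNS :=
  (f.toPreGNS.toLinearMap ∘ₗ idealMul hι hl e ∘ₗ f.ofPreGNS.toLinearMap).mkContinuous ‖e‖
    fun x => norm_toPreGNS_idealMul_le f hι hl e (f.ofPreGNS x)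

/-- The operator `[a] ↦ [e a]` on the GNS space of a functional on an ideal. -/
def gnsIdealMul (e : E) : f.GNS →L[ℂ] f.GNS := (preGNSIdealMul f hι hl e).completion

lemma gnsIdealMul_coe (e : E) (a : L) :
    gnsIdealMul f hι hl e (f.toPreGNS a : f.GNS) = (f.toPreGNS (idealMul hι hl e a) : f.GNS) := by
  rw [gnsIdealMul, ContinuousLinearMap.completion_apply_coe]
  rfl

lemma gns_clm_ext {S T : f.GNS →L[ℂ] f.GNS}
    (h : ∀ a : L, S (f.toPreGNS a : f.GNS) = T (f.toPreGNS a : f.GNS)) : S = T :=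
  ContinuousLinearMap.coeFn_injective
    ((denseRange_coe_toPreGNS f).equalizer S.continuous T.continuous (funext h))

/-- The GNS representation of a positive functional on an ideal, extended to the ambient algebra. -/
def gnsIdealExtension : E →⋆ₙₐ[ℂ] (f.GNS →L[ℂ] f.GNS) where
  toFun := gnsIdealMul f hι hl
  map_smul' c e := gns_clm_ext f fun a => by
    simp only [gnsIdealMul_coe, smul_idealMul, map_smul, Completion.coe_smul, MonoidHom.id_apply,
      _root_.smul_apply]
  map_zero' := gns_clm_ext f fun a => by
    have : idealMul hι hl 0 a = 0 := by simpa using smul_idealMul hι hl 0 0 a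
    simp only [gnsIdealMul_coe, this, map_zero, Completion.coe_zero, _root_.zero_apply]
  map_add' e e' := gns_clm_ext f fun a => by
    simp only [gnsIdealMul_coe, add_idealMul, map_add, Completion.coe_add,
      _root_.add_apply]
  map_mul' e e' := gns_clm_ext f fun a => by
    simp only [gnsIdealMul_coe, mul_idealMul, mul_apply_eq_comp]
  map_star' e := by
    rw [ContinuousLinearMap.star_eq_adjoint, ContinuousLinearMap.eq_adjoint_iff]
    intro x y
    refine (denseRange_coe_toPreGNS f).induction_on₂
      (p := fun x y => inner ℂ (gnsIdealMul f hι hl (star e) x) y =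
        inner ℂ x (gnsIdealMul f hι hl e y)) ?_ ?_ x y
    · apply isClosed_eq <;> fun_prop
    · intro a b
      rw [gnsIdealMul_coe, gnsIdealMul_coe, inner_coe_toPreGNS, inner_coe_toPreGNS,
        star_idealMul_mul, star_star]

lemma gnsIdealExtension_coe (e : E) (a : L) :
    gnsIdealExtension f hι hl e (f.toPreGNS a : f.GNS) =
      (f.toPreGNS (idealMul hι hl e a) : f.GNS) :=
  gnsIdealMul_coe f hι hl e a

lemma gnsIdealExtension_map (l : L) :
    gnsIdealExtension f hι hl (ι l) = f.gnsNonUnitalStarAlgHom l :=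
  gns_clm_ext f fun a => by
    rw [gnsIdealExtension_coe, idealMul_map, gns_coe_toPreGNS]

end GNS

/-! ### The cyclic vector of a state on a possibly non-unital algebra -/

section Cyclic

open UniformSpace PositiveLinearMap

variable {L : Type*} [NonUnitalCStarAlgebra L] [PartialOrder L] (ω : State L)

lemma State.norm_apply_le (a : L) : ‖ω a‖ ≤ ‖a‖ := by
  simpa [ω.2.2] using ω.1.le_opNorm a

variable [StarOrderedRing L]

lemma State.norm_toPreGNS_le (a : L) : ‖ω.toPositive.toPreGNS a‖ ≤ ‖a‖ := by
  rw [preGNS_norm_def, ofPreGNS_toPreGNS]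
  refine Real.sqrt_le_iff.2 ⟨norm_nonneg _, (Complex.re_le_norm _).trans ?_⟩
  rw [sq, ← CStarRing.norm_star_mul_self]
  exact ω.norm_apply_le _

/-- Cauchy–Schwarz for `ω(ua) = ⟪[u*], [a]⟫` with `‖[u*]‖ ≤ 1`, followed by `ua → a`. This makes
`[a] ↦ ω(a)` well defined and bounded, so that the Riesz theorem can supply the cyclic vector in
place of the class of a unit. -/
lemma State.norm_apply_le_norm_toPreGNS (a : L) : ‖ω a‖ ≤ ‖ω.toPositive.toPreGNS a‖ := by
  have := (increasingApproximateUnit L).neBot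
  have ht : Tendsto (fun u => ‖ω (u * a)‖) (approximateUnit L) (𝓝 ‖ω a‖) :=
    (ω.1.continuous.norm.tendsto a).comp ((increasingApproximateUnit L).tendsto_mul_right a)
  refine le_of_tendsto ht ?_
  filter_upwards [(increasingApproximateUnit L).eventually_norm] with u hu
  have h := norm_inner_le_norm (𝕜 := ℂ) (ω.toPositive.toPreGNS (star u)) (ω.toPositive.toPreGNS a)
  rw [preGNS_inner_def, ofPreGNS_toPreGNS, ofPreGNS_toPreGNS, star_star] at h
  refine h.trans (mul_le_of_le_one_left (norm_nonneg _) ((ω.norm_toPreGNS_le _).trans ?_))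
  rwa [norm_star]

/-- A state on a C*-algebra is implemented by a vector in its GNS space. -/
lemma State.exists_gnsVector : ∃ Ω : ω.toPositive.GNS,
    ∀ a : L, ω.toPositive.gnsNonUnitalStarAlgHom a Ω = (ω.toPositive.toPreGNS a : ω.toPositive.GNS)
      ∧ inner ℂ Ω (ω.toPositive.toPreGNS a : ω.toPositive.GNS) = ω a := by
  set f := ω.toPositive
  let g : f.PreGNS →L[ℂ] ℂ :=
    ((ω.1 : L →ₗ[ℂ] ℂ) ∘ₗ f.ofPreGNS.toLinearMap).mkContinuous 1 fun x => by
      rw [one_mul]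
      exact ω.norm_apply_le_norm_toPreGNS (f.ofPreGNS x)
  let G : StrongDual ℂ f.GNS := g.extend (Completion.toComplL (𝕜 := ℂ) (E := f.PreGNS))
  have hG : ∀ a : L, G (f.toPreGNS a : f.GNS) = ω a := fun a =>
    ContinuousLinearMap.extend_eq g Completion.denseRange_coe
      (Completion.isUniformInducing_coe _) (f.toPreGNS a)
  let Ω := (InnerProductSpace.toDual ℂ f.GNS).symm G
  have hΩ : ∀ a : L, inner ℂ Ω (f.toPreGNS a : f.GNS) = ω a := fun a => by
    rw [InnerProductSpace.toDual_symm_apply, hG]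
  refine ⟨Ω, fun a => ⟨?_, hΩ a⟩⟩
  -- Against `[b]`, both sides give `ω(a*b)`.
  refine (denseRange_coe_toPreGNS f).eq_of_inner_left ℂ fun b => ?_
  rw [inner_rep_left, gns_coe_toPreGNS, hΩ, inner_coe_toPreGNS]
  rfl

/-- The cyclic vector of the GNS representation of a state. -/
def State.gnsVector : ω.toPositive.GNS := ω.exists_gnsVector.choose

@[simp]
lemma State.gns_apply_gnsVector (a : L) :
    ω.toPositive.gnsNonUnitalStarAlgHom a ω.gnsVector =
      (ω.toPositive.toPreGNS a : ω.toPositive.GNS) :=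
  (ω.exists_gnsVector.choose_spec a).1

lemma State.inner_gnsVector (a : L) :
    inner ℂ ω.gnsVector (ω.toPositive.gnsNonUnitalStarAlgHom a ω.gnsVector) = ω a := by
  rw [ω.gns_apply_gnsVector]
  exact (ω.exists_gnsVector.choose_spec a).2

end Cyclic

/-! ### Nondegeneracy of the universal representation -/

section Nondegenerate

variable {A : Type*} [NonUnitalCStarAlgebra A]

/-- Since the range of `π` is closed under adjoints, the orthogonal complement of the essential
subspace is killed by every `π(a)`. -/
lemma essentialSubspace_eq_top {H : Type*} [NormedAddCommGroup H] [InnerProductSpace ℂ H]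
    [CompleteSpace H] (π : A →⋆ₙₐ[ℂ] (H →L[ℂ] H)) (h : ∀ x, (∀ a, π a x = 0) → x = 0) :
    essentialSubspace (Set.range π) = ⊤ := by
  rw [essentialSubspace, Submodule.topologicalClosure_eq_top_iff, Submodule.eq_bot_iff]
  refine fun x hx => h x fun a => ?_
  refine ext_inner_right ℂ fun v => ?_
  rw [inner_rep_left, inner_zero_left]
  exact (Submodule.mem_orthogonal' _ x).1 hx _
    (Submodule.subset_span ⟨_, Set.mem_range_self (star a), v, rfl⟩)

lemma universalRep_nondegenerate [PartialOrder A] [StarOrderedRing A] :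
    essentialSubspace (Set.range (universalRep A)) = ⊤ := by
  refine essentialSubspace_eq_top _ fun x hx => lp.ext (funext fun ω => ?_)
  exact eq_zero_of_gns_apply_eq_zero _ fun a => congrArg (fun y : UniversalSpace A => y ω) (hx a)

end Nondegenerate

/-! ### Commutants of `L` and `F` -/

section Commutant

variable {E : Type*} [CStarAlgebra E] {H : Type*} [NormedAddCommGroup H] [InnerProductSpace ℂ H]
  [CompleteSpace H]

/-- Two representations of `E` that agree on a left ideal acting nondegenerately are
equal. -/
lemma rep_eq_of_eq_on_ideal {L : Type*} [NonUnitalCStarAlgebra L] {ι : L →⋆ₙₐ[ℂ] E}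
    (hl : ∀ (e : E) (l : L), e * ι l ∈ Set.range ι) {ρ σ : E →⋆ₙₐ[ℂ] (H →L[ℂ] H)}
    (h : ∀ l, ρ (ι l) = σ (ι l))
    (htop : essentialSubspace (Set.range fun l : L => ρ (ι l)) = ⊤) : ρ = σ := by
  ext e x
  have hle : essentialSubspace (Set.range fun l : L => ρ (ι l)) ≤
      LinearMap.eqLocus (ρ e : H →ₗ[ℂ] H) (σ e : H →ₗ[ℂ] H) := by
    refine Submodule.topologicalClosure_minimal _ (Submodule.span_le.2 ?_)
      (isClosed_eq (ρ e).continuous (σ e).continuous)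
    rintro _ ⟨_, ⟨l, rfl⟩, v, rfl⟩
    change ρ e (ρ (ι l) v) = σ e (ρ (ι l) v)
    obtain ⟨m, hm⟩ := hl e l
    rw [← mul_apply_eq_comp, ← map_mul, h l, ← mul_apply_eq_comp, ← map_mul, ← hm, h m]
  exact hle (htop ▸ Submodule.mem_top)

/-- If the closed cyclic subspaces generated by `q` in the doubled representation are contained in
those generated by `p`, the commutant of `p` is contained in that of `q`: apply the hypothesis to
the graph of an operator. -/
lemma centralizer_subset_of_cyclicSubspace_le {α β : Type*} (π : E →⋆ₙₐ[ℂ] (H →L[ℂ] H))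
    (p : α → E) (q : β → E)
    (h : ∀ Ω : lp (fun _ : Bool => H) 2,
      cyclicSubspace (Set.range fun b => directSumRep (fun _ : Bool => π) (q b)) Ω ≤
        cyclicSubspace (Set.range fun a => directSumRep (fun _ : Bool => π) (p a)) Ω) :
    Set.centralizer (Set.range fun a => π (p a)) ⊆ Set.centralizer (Set.range fun b => π (q b)) := by
  rintro T hT _ ⟨b, rfl⟩
  ext v
  -- `Ω = (v, Tv)` lies on the graph `G` of `T`. As `T` commutes with each `π(p a)`, the whole
  -- `p`-cyclic subspace stays in `G`; that it contains the `q b`-image of `Ω` says `π(q b)Tv = Tπ(q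
  -- b)v`.
  let Ω : lp (fun _ : Bool => H) 2 := ⟨fun i => if i then T v else v, Memℓp.all _⟩
  have hc : ∀ i : Bool, Continuous fun x : lp (fun _ : Bool => H) 2 => x i := fun i =>
    (LipschitzWith.of_dist_le_mul (K := 1) fun x y => by
      rw [dist_eq_norm, dist_eq_norm, NNReal.coe_one, one_mul]
      exact lp.norm_apply_le_norm (by norm_num) (x - y) i).continuous
  let G : Submodule ℂ (lp (fun _ : Bool => H) 2) :=
    { carrier := {x | x true = T (x false)}
      add_mem' := fun {x y} (hx : x true = T (x false)) (hy : y true = T (y false)) => by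
        change x true + y true = T (x false + y false)
        rw [hx, hy, map_add]
      zero_mem' := (map_zero T).symm
      smul_mem' := fun c x (hx : x true = T (x false)) => by
        change c • x true = T (c • x false)
        rw [hx, map_smul] }
  have hle : cyclicSubspace (Set.range fun a => directSumRep (fun _ : Bool => π) (p a)) Ω ≤ G := by
    refine cyclicSubspace_le (isClosed_eq (hc true) (T.continuous.comp (hc false))) ?_
    rintro _ ⟨a, rfl⟩
    exact congrArg (fun S : H →L[ℂ] H => S v) (hT (π (p a)) ⟨a, rfl⟩)
  exact hle (h Ω (apply_mem_cyclicSubspace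
    (Set.mem_range_self (f := fun b => directSumRep (fun _ : Bool => π) (q b)) b) Ω))

variable {F : Type*} [CStarAlgebra F] [PartialOrder F] [StarOrderedRing F]
  [PartialOrder E] [StarOrderedRing E]
  {L : Type*} [NonUnitalCStarAlgebra L] [PartialOrder L] [StarOrderedRing L]
  {S₀ : Set (State F)} {ι : L →⋆ₙₐ[ℂ] E} {ξ : F →⋆ₐ[ℂ] E}

/-- In a representation that is nondegenerate on `L`, the algebras `L` and `F` have the same
commutant. -/
theorem IsIdealHost.centralizer_eq (hL : IsIdealHost S₀ ι ξ) (π : E →⋆ₙₐ[ℂ] (H →L[ℂ] H))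
    (hπ : ∀ x, (∀ l, π (ι l) x = 0) → x = 0) :
    Set.centralizer (Set.range fun f : F => π (ξ f)) =
      Set.centralizer (Set.range fun l : L => π (ι l)) := by
  have htop : essentialSubspace
      (Set.range ((directSumRep fun _ : Bool => π).comp ι)) = ⊤ := by
    refine essentialSubspace_eq_top _ fun x hx => lp.ext (funext fun i => ?_)
    exact hπ _ fun l => congrArg (fun y : lp (fun _ : Bool => H) 2 => y i) (hx l)
  have key : ∀ Ω, _ := fun Ω => hL.cyclicSubspace_eq (directSumRep fun _ : Bool => π) (Ω := Ω)
    ((htop ▸ Submodule.mem_top :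
      Ω ∈ essentialSubspace (Set.range ((directSumRep fun _ : Bool => π).comp ι))))
  exact Set.Subset.antisymm
    (centralizer_subset_of_cyclicSubspace_le π ξ ι fun Ω => (key Ω).le)
    (centralizer_subset_of_cyclicSubspace_le π ι ξ fun Ω => (key Ω).ge)

end Commutant

/-! ### Uniqueness of state extensions from an ideal -/

section Extension

open PositiveLinearMap

variable {L : Type*} [NonUnitalCStarAlgebra L] [PartialOrder L] [StarOrderedRing L]

lemma State.gnsVector_mem_essentialSubspace (ω : State L) :
    ω.gnsVector ∈ essentialSubspace (Set.range ω.toPositive.gnsNonUnitalStarAlgHom) := by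
  rw [essentialSubspace_eq_top _ fun x => eq_zero_of_gns_apply_eq_zero _]
  exact Submodule.mem_top

/-- `‖Ω‖² = lim |ω(u)| ≤ 1`, while `|ω(a)| ≤ ‖a‖ ‖Ω‖²` together with `‖ω‖ = 1` forces `‖Ω‖ ≥ 1`. -/
lemma State.norm_gnsVector (ω : State L) : ‖ω.gnsVector‖ = 1 := by
  have := (increasingApproximateUnit L).neBot
  refine le_antisymm ?_ ?_
  · have ht : Tendsto (fun u => ‖ω u‖) (approximateUnit L) (𝓝 (‖ω.gnsVector‖ ^ 2)) := by
      have h := ((tendsto_const_nhds (x := ω.gnsVector)).inner (𝕜 := ℂ)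
        (tendsto_approximateUnit_apply _ ω.gnsVector_mem_essentialSubspace)).norm
      simp only [ω.inner_gnsVector] at h
      simpa using h
    have h : ‖ω.gnsVector‖ ^ 2 ≤ 1 := by
      refine le_of_tendsto ht ?_
      filter_upwards [(increasingApproximateUnit L).eventually_norm] with u hu
      exact (ω.norm_apply_le u).trans hu
    exact (sq_le_one_iff₀ (norm_nonneg _)).1 h
  · have h : ‖ω.1‖ ≤ ‖ω.gnsVector‖ ^ 2 := by
      refine ContinuousLinearMap.opNorm_le_bound _ (by positivity) fun a => ?_
      change ‖ω a‖ ≤ _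
      rw [← ω.inner_gnsVector]
      refine (norm_inner_le_norm _ _).trans ?_
      calc _ ≤ ‖ω.gnsVector‖ * (‖a‖ * ‖ω.gnsVector‖) := by gcongr; exact norm_rep_apply_le _ _ _
        _ = _ := by ring
    rw [ω.2.2] at h
    exact (one_le_sq_iff₀ (norm_nonneg _)).1 h

lemma State.tendsto_approximateUnit (ω : State L) :
    Tendsto (fun u => ω u) (approximateUnit L) (𝓝 1) := by
  have h := (tendsto_const_nhds (x := ω.gnsVector)).inner (𝕜 := ℂ)
    (tendsto_approximateUnit_apply _ ω.gnsVector_mem_essentialSubspace)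
  simp only [ω.inner_gnsVector] at h
  simpa [ω.norm_gnsVector] using h

variable {E : Type*} [CStarAlgebra E] [PartialOrder E] [StarOrderedRing E] {ι : L →⋆ₙₐ[ℂ] E}

/-- The cyclic vector of an extension of a state of `L` is in the essential subspace of `L`. -/
lemma State.gnsVector_mem_essentialSubspace_of_extends {ψ : State E} {ω : State L}
    (h : ∀ l, ψ (ι l) = ω l) :
    ψ.gnsVector ∈
      essentialSubspace (Set.range fun l : L => ψ.toPositive.gnsNonUnitalStarAlgHom (ι l)) := by
  have := (increasingApproximateUnit L).neBot
  set π := ψ.toPositive.gnsNonUnitalStarAlgHom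
  set Ω := ψ.gnsVector
  have ht : Tendsto (fun u : L => π (ι u) Ω) (approximateUnit L) (𝓝 Ω) := by
    rw [tendsto_iff_norm_sub_tendsto_zero]
    -- Expanding the square gives `‖π(u)Ω - Ω‖² ≤ 2 - 2 Re ω(u)`, and `ω(u) → 1`.
    have h1 : Tendsto (fun u => 2 - 2 * (ω u).re) (approximateUnit L) (𝓝 0) := by
      have := ((Complex.continuous_re.tendsto _).comp ω.tendsto_approximateUnit).const_mul 2
        |>.const_sub 2
      simpa using this
    have h2 : Tendsto (fun u : L => ‖π (ι u) Ω - Ω‖ ^ 2) (approximateUnit L) (𝓝 0) := by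
      refine squeeze_zero' (Eventually.of_forall fun u => by positivity) ?_ h1
      filter_upwards [(increasingApproximateUnit L).eventually_norm] with u hu
      have h3 : ‖π (ι u) Ω‖ ≤ 1 := by
        refine (norm_rep_apply_le π _ _).trans ?_
        rw [ψ.norm_gnsVector, mul_one]
        exact (NonUnitalStarAlgHom.norm_apply_le ι u).trans hu
      have h4 : inner ℂ Ω (π (ι u) Ω) = ω u := by rw [ψ.inner_gnsVector, h]
      rw [norm_sub_sq (𝕜 := ℂ), ψ.norm_gnsVector, inner_re_symm, h4]
      have : ‖π (ι u) Ω‖ ^ 2 ≤ 1 := pow_le_one₀ (norm_nonneg _) h3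
      simp only [RCLike.re_eq_complex_re]
      linarith
    simpa [Function.comp_def, Real.sqrt_sq] using (Real.continuous_sqrt.tendsto 0).comp h2
  exact (Submodule.isClosed_topologicalClosure _).mem_of_tendsto ht
    (Eventually.of_forall fun u => apply_mem_essentialSubspace
      (Set.mem_range_self (f := fun l : L => π (ι l)) u) Ω)

/-- The extension of a state from an ideal is unique. -/
lemma State.extension_unique (hl : ∀ (e : E) (l : L), e * ι l ∈ Set.range ι) {ψ ψ' : State E}
    {ω : State L} (h : ∀ l, ψ (ι l) = ω l) (h' : ∀ l, ψ' (ι l) = ω l) (e : E) : ψ e = ψ' e := by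
  have := (increasingApproximateUnit L).neBot
  -- Any extension is determined by `χ(e) = lim χ(eu)`, where `eu` lies in `L`.
  have key : ∀ χ : State E, (∀ l, χ (ι l) = ω l) →
      Tendsto (fun u : L => χ (e * ι u)) (approximateUnit L) (𝓝 (χ e)) := fun χ hχ => by
    have := (tendsto_const_nhds (x := χ.gnsVector)).inner (𝕜 := ℂ)
      (rep_mul_ideal_tendsto _ (State.gnsVector_mem_essentialSubspace_of_extends hχ) e)
    simpa only [χ.inner_gnsVector] using this
  refine tendsto_nhds_unique (key ψ h) ((key ψ' h').congr fun u => ?_)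
  obtain ⟨l, hl⟩ := hl e u
  rw [← hl, h, h']

end Extension

/-! ### The bijection `θ` between states of `L` and `S₀` -/

section Theta

open PositiveLinearMap

variable {F : Type*} [CStarAlgebra F] [PartialOrder F] {E : Type*} [CStarAlgebra E] [PartialOrder E]
  {L : Type*} [NonUnitalCStarAlgebra L] [PartialOrder L] [StarOrderedRing L]
  {S₀ : Set (State F)} {ι : L →⋆ₙₐ[ℂ] E} {ξ : F →⋆ₐ[ℂ] E}

/-- The extension of the GNS representation of a state of `L` to `E`. -/
def IsIdealHost.gnsExtension (hL : IsIdealHost S₀ ι ξ) (ω : State L) :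
    E →⋆ₙₐ[ℂ] (ω.toPositive.GNS →L[ℂ] ω.toPositive.GNS) :=
  gnsIdealExtension ω.toPositive hL.injective hL.mul_left_mem

lemma IsIdealHost.gnsExtension_map (hL : IsIdealHost S₀ ι ξ) (ω : State L) (l : L) :
    hL.gnsExtension ω (ι l) = ω.toPositive.gnsNonUnitalStarAlgHom l :=
  gnsIdealExtension_map _ _ _ l

lemma IsIdealHost.gnsExtension_comp (hL : IsIdealHost S₀ ι ξ) (ω : State L) :
    (hL.gnsExtension ω).comp ι = ω.toPositive.gnsNonUnitalStarAlgHom :=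
  NonUnitalStarAlgHom.ext (hL.gnsExtension_map ω)

lemma IsIdealHost.gnsVector_mem (hL : IsIdealHost S₀ ι ξ) (ω : State L) :
    ω.gnsVector ∈ essentialSubspace (Set.range ((hL.gnsExtension ω).comp ι)) := by
  rw [hL.gnsExtension_comp]
  exact ω.gnsVector_mem_essentialSubspace

variable [StarOrderedRing F] [StarOrderedRing E]

/-- The map `θ` from the states of `L` to the states of `F`. -/
def IsIdealHost.theta (hL : IsIdealHost S₀ ι ξ) (ω : State L) : State F :=
  vectorState ((hL.gnsExtension ω).comp ξ.toNonUnitalStarAlgHom) ω.gnsVector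
    (mem_essentialSubspace_comp _ ξ (mem_essentialSubspace_of_ideal _ (hL.gnsVector_mem ω)))
    ω.norm_gnsVector

lemma IsIdealHost.isTheta_theta (hL : IsIdealHost S₀ ι ξ) (ω : State L) :
    IsTheta ι ξ ω (hL.theta ω) := by
  obtain ⟨ψ, h₁, h₂⟩ := isTheta_vectorState (ξ := ξ) (hL.gnsExtension ω) (hL.gnsVector_mem ω)
    ω.norm_gnsVector (mem_essentialSubspace_of_ideal _ (hL.gnsVector_mem ω))
  refine ⟨ψ, fun l => (h₁ l).trans ?_, h₂⟩
  rw [vectorState_apply, hL.gnsExtension_comp, ω.inner_gnsVector]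

lemma IsIdealHost.theta_mem (hL : IsIdealHost S₀ ι ξ) (ω : State L) : hL.theta ω ∈ S₀ :=
  (hL.theta_range _).2 ⟨ω, hL.isTheta_theta ω⟩

/-- `IsTheta` is only a relation; uniqueness of the extended state makes it the graph of `theta`,
which turns the range condition into surjectivity onto `S₀`. -/
lemma IsIdealHost.eq_theta (hL : IsIdealHost S₀ ι ξ) {ω : State L} {φ : State F}
    (h : IsTheta ι ξ ω φ) : φ = hL.theta ω := by
  obtain ⟨ψ, h₁, h₂⟩ := h
  obtain ⟨ψ', h₁', h₂'⟩ := hL.isTheta_theta ω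
  refine Subtype.ext (ContinuousLinearMap.ext fun f => ?_)
  exact (h₂ f).trans
    ((State.extension_unique hL.mul_left_mem h₁ h₁' (ξ f)).trans (h₂' f).symm)

/-- The map `θ` as a bijection from the states of `L` onto `S₀`. -/
def IsIdealHost.thetaEquiv (hL : IsIdealHost S₀ ι ξ) : State L ≃ S₀ :=
  Equiv.ofBijective (fun ω => ⟨hL.theta ω, hL.theta_mem ω⟩) ⟨fun ω₁ ω₂ h =>
    hL.theta_injective ω₁ ω₂ _ (hL.isTheta_theta ω₁)
      ((show hL.theta ω₂ = hL.theta ω₁ from (congrArg Subtype.val h).symm) ▸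
        hL.isTheta_theta ω₂),
    fun φ => by
      obtain ⟨ω, hω⟩ := (hL.theta_range φ.1).1 φ.2
      exact ⟨ω, Subtype.ext (hL.eq_theta hω).symm⟩⟩

end Theta

/-! ### Unitary equivalences and transport of commutants -/

section Unitaries

open PositiveLinearMap UniformSpace

/-- A cyclic representation with cyclic vector implementing `f` is unitarily equivalent to the GNS
representation of `f`. -/
lemma exists_gns_unitary {A : Type*} [NonUnitalCStarAlgebra A] [PartialOrder A] [StarOrderedRing A]
    (f : A →ₚ[ℂ] ℂ) {K : Type*} [NormedAddCommGroup K] [InnerProductSpace ℂ K] [CompleteSpace K]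
    (π : A →⋆ₙₐ[ℂ] (K →L[ℂ] K)) (Ω : K) (hΩ : ∀ a, f a = inner ℂ Ω (π a Ω))
    (hcyc : DenseRange fun a => π a Ω) :
    ∃ W : f.GNS ≃ₗᵢ[ℂ] K, ∀ a x, W (f.gnsNonUnitalStarAlgHom a x) = π a (W x) := by
  let V₀ : f.PreGNS →ₗ[ℂ] K :=
    { toFun := fun x => π (f.ofPreGNS x) Ω
      map_add' := fun x y => by simp
      map_smul' := fun c x => by simp }
  have hV₀ : ∀ x, ‖V₀ x‖ = ‖x‖ := fun x => by
    rw [← sq_eq_sq₀ (norm_nonneg _) (norm_nonneg _)]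
    have : ((‖V₀ x‖ ^ 2 : ℝ) : ℂ) = ((‖x‖ ^ 2 : ℝ) : ℂ) := by
      push_cast
      rw [preGNS_norm_sq, hΩ, map_mul, mul_apply_eq_comp, ← inner_rep_left]
      exact (inner_self_eq_norm_sq_to_K (𝕜 := ℂ) (π (f.ofPreGNS x) Ω)).symm
    exact_mod_cast this
  let V₁ : f.PreGNS →L[ℂ] K := V₀.mkContinuous 1 fun x => by rw [hV₀, one_mul]
  let V : f.GNS →L[ℂ] K := V₁.extend (Completion.toComplL (𝕜 := ℂ) (E := f.PreGNS))
  have hV : ∀ a : A, V (f.toPreGNS a : f.GNS) = π a Ω := fun a =>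
    ContinuousLinearMap.extend_eq V₁ Completion.denseRange_coe
      (Completion.isUniformInducing_coe _) (f.toPreGNS a)
  have hVn : ∀ x, ‖V x‖ = ‖x‖ := fun x =>
    (denseRange_coe_toPreGNS f).induction_on (p := fun x => ‖V x‖ = ‖x‖) x
      (isClosed_eq V.continuous.norm continuous_norm)
      fun a => by rw [hV, Completion.norm_coe]; exact hV₀ (f.toPreGNS a)
  let W : f.GNS →ₗᵢ[ℂ] K := ⟨V.toLinearMap, hVn⟩
  have hW : Function.Surjective W := by
    rw [← Set.range_eq_univ, ← W.isometry.isClosedEmbedding.isClosed_range.closure_eq]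
    refine Dense.closure_eq (hcyc.mono ?_)
    rintro _ ⟨a, rfl⟩
    exact ⟨_, hV a⟩
  refine ⟨LinearIsometryEquiv.ofSurjective W hW, fun a x => ?_⟩
  change V _ = π a (V x)
  refine (denseRange_coe_toPreGNS f).induction_on
    (p := fun x => V (f.gnsNonUnitalStarAlgHom a x) = π a (V x)) x
    (isClosed_eq (by fun_prop) (by fun_prop)) fun b => ?_
  rw [gns_coe_toPreGNS, hV, hV, map_mul, mul_apply_eq_comp]

/-- The Hilbert sum of unitaries along a bijection of the index sets. -/
lemma exists_lp_unitary {α β : Type*} (e : α ≃ β) {H : β → Type*} {K : α → Type*}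
    [∀ i, NormedAddCommGroup (H i)] [∀ i, InnerProductSpace ℂ (H i)]
    [∀ i, NormedAddCommGroup (K i)] [∀ i, InnerProductSpace ℂ (K i)]
    (W : ∀ a, H (e a) ≃ₗᵢ[ℂ] K a) :
    ∃ U : lp H 2 ≃ₗᵢ[ℂ] lp K 2, ∀ x a, U x a = W a (x (e a)) := by
  have h2 : (0 : ℝ) < (2 : ENNReal).toReal := by norm_num
  have hmem : ∀ x : lp H 2, Memℓp (fun a => W a (x (e a))) 2 := fun x => by
    refine memℓp_gen ?_
    simp only [LinearIsometryEquiv.norm_map]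
    exact e.summable_iff.2 ((lp.memℓp x).summable h2)
  let U : lp H 2 →ₗᵢ[ℂ] lp K 2 :=
    { toFun := fun x => ⟨fun a => W a (x (e a)), hmem x⟩
      map_add' := fun x y => lp.ext (funext fun a => map_add (W a) _ _)
      map_smul' := fun c x => lp.ext (funext fun a => map_smul (W a) c _)
      norm_map' := fun x => by
        rw [← Real.rpow_left_inj (norm_nonneg _) (norm_nonneg _) h2.ne',
          lp.norm_rpow_eq_tsum h2, lp.norm_rpow_eq_tsum h2]
        refine Eq.trans (tsum_congr fun a => ?_)
          (e.tsum_eq fun b => ‖x b‖ ^ (2 : ENNReal).toReal)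
        exact congrArg (· ^ (2 : ENNReal).toReal) ((W a).norm_map _) }
  have hU : Function.Surjective U := fun y => by
    let x : ∀ b, H b := Equiv.piCongrLeft H e fun a => (W a).symm (y a)
    have hx : ∀ a, x (e a) = (W a).symm (y a) := Equiv.piCongrLeft_apply_apply H e _
    have hxm : Memℓp x 2 := by
      refine memℓp_gen (e.summable_iff.1 (((lp.memℓp y).summable h2).congr fun a => ?_))
      simp only [Function.comp_apply, hx, LinearIsometryEquiv.norm_map]
    refine ⟨⟨x, hxm⟩, lp.ext (funext fun a => ?_)⟩
    change W a (x (e a)) = y a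
    rw [hx, LinearIsometryEquiv.apply_symm_apply]
  exact ⟨LinearIsometryEquiv.ofSurjective U hU, fun _ _ => rfl⟩

lemma image_centralizer {R S : Type*} [Mul R] [Mul S] (Φ : R ≃* S) (M : Set R) :
    Φ '' Set.centralizer M = Set.centralizer (Φ '' M) := by
  ext s
  obtain ⟨r, rfl⟩ := Φ.surjective s
  rw [Φ.injective.mem_set_image, Set.mem_centralizer_iff, Set.mem_centralizer_iff,
    Set.forall_mem_image]
  simp only [← map_mul, Φ.injective.eq_iff]

/-- Commutants depend only on multiplication, so conjugation by any bounded invertible map carries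
them along. -/
lemma image_doubleCommutant {H K : Type*} [NormedAddCommGroup H] [InnerProductSpace ℂ H]
    [NormedAddCommGroup K] [InnerProductSpace ℂ K] (U : H ≃L[ℂ] K) (M : Set (H →L[ℂ] H)) :
    U.conjContinuousAlgEquiv '' doubleCommutant M =
      doubleCommutant (U.conjContinuousAlgEquiv '' M) := by
  have h := fun N => image_centralizer U.conjContinuousAlgEquiv.toAlgEquiv.toMulEquiv N
  have h₁ := h (Set.centralizer M)
  rw [h M] at h₁
  exact h₁

end Unitaries

/-! ### The universal representation of `L` restricted to `F` -/

section Universal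

variable {F : Type*} [CStarAlgebra F] [PartialOrder F]
  {E : Type*} [CStarAlgebra E] [PartialOrder E]
  {L : Type*} [NonUnitalCStarAlgebra L] [PartialOrder L] [StarOrderedRing L]
  {S₀ : Set (State F)} {ι : L →⋆ₙₐ[ℂ] E} {ξ : F →⋆ₐ[ℂ] E}

/-- The extension to `E` of the universal representation of `L`. -/
def IsIdealHost.universalExtension (hL : IsIdealHost S₀ ι ξ) :
    E →⋆ₙₐ[ℂ] (UniversalSpace L →L[ℂ] UniversalSpace L) :=
  directSumRep fun ω : (Set.univ : Set (State L)) => hL.gnsExtension ω.1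

lemma IsIdealHost.universalExtension_map (hL : IsIdealHost S₀ ι ξ) (l : L) :
    hL.universalExtension (ι l) = universalRep L l := by
  ext x ω
  change hL.gnsExtension ω.1 (ι l) (x ω) = _
  rw [hL.gnsExtension_map]
  rfl

/-- `universalRep L` is nondegenerate, so an extension is fixed by its values on `ι(L)`. -/
lemma IsIdealHost.eq_universalExtension (hL : IsIdealHost S₀ ι ξ)
    {ρ : E →⋆ₙₐ[ℂ] (UniversalSpace L →L[ℂ] UniversalSpace L)}
    (h : ∀ l : L, ρ (ι l) = universalRep L l) : ρ = hL.universalExtension :=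
  rep_eq_of_eq_on_ideal hL.mul_left_mem
    (fun l => (h l).trans (hL.universalExtension_map l).symm)
    ((congrArg (fun g => essentialSubspace (Set.range g)) (funext h)).trans
      universalRep_nondegenerate)

variable [StarOrderedRing F] [StarOrderedRing E]

/-- The extended GNS representation of a state `ω` of `L`, restricted to `F`, is the GNS
representation of `θ(ω)`. -/
lemma IsIdealHost.exists_unitary_theta (hL : IsIdealHost S₀ ι ξ) (ω : State L) :
    ∃ W : ω.toPositive.GNS ≃ₗᵢ[ℂ] (hL.theta ω).toPositive.GNS,
      ∀ f x, W (hL.gnsExtension ω (ξ f) x) =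
        (hL.theta ω).toPositive.gnsNonUnitalStarAlgHom f (W x) := by
  suffices hcyc : DenseRange fun f : F => hL.gnsExtension ω (ξ f) ω.gnsVector by
    obtain ⟨W, h⟩ := exists_gns_unitary (hL.theta ω).toPositive
      ((hL.gnsExtension ω).comp ξ.toNonUnitalStarAlgHom) ω.gnsVector
      (fun _ => rfl) hcyc
    refine ⟨W.symm, fun f x => ?_⟩
    rw [LinearIsometryEquiv.symm_apply_eq, h, LinearIsometryEquiv.apply_symm_apply]
    rfl
  have h := hL.cyclicSubspace_eq (hL.gnsExtension ω) (hL.gnsVector_mem ω)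
  -- The orbit of the vector under `F` is already a linear subspace, so density of the span is
  -- density of the orbit.
  have hspan : ∀ v ∈ Submodule.span ℂ {v | ∃ T ∈ Set.range fun f : F => hL.gnsExtension ω (ξ f),
      v = T ω.gnsVector}, ∃ f : F, hL.gnsExtension ω (ξ f) ω.gnsVector = v := by
    intro v hv
    induction hv using Submodule.span_induction with
    | mem v hv => obtain ⟨_, ⟨f, rfl⟩, rfl⟩ := hv; exact ⟨f, rfl⟩
    | zero => exact ⟨0, by simp⟩
    | add v w _ _ hv hw =>
      obtain ⟨a, rfl⟩ := hv
      obtain ⟨b, rfl⟩ := hw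
      exact ⟨a + b, by simp⟩
    | smul c v _ hv => obtain ⟨a, rfl⟩ := hv; exact ⟨c • a, by simp⟩
  -- The vector is cyclic for `L`, since its orbit consists of all classes `[a]`; equality of cyclic
  -- subspaces passes this on to `F`.
  have hL' : cyclicSubspace (Set.range fun l : L => hL.gnsExtension ω (ι l)) ω.gnsVector = ⊤ := by
    rw [Submodule.eq_top_iff']
    refine fun x => (denseRange_coe_toPreGNS ω.toPositive).induction_on
      (p := fun x => x ∈ cyclicSubspace _ _) x (isClosed_cyclicSubspace _ _) fun a => ?_
    rw [← ω.gns_apply_gnsVector, ← hL.gnsExtension_map]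
    exact apply_mem_cyclicSubspace
      (Set.mem_range_self (f := fun l : L => hL.gnsExtension ω (ι l)) a) _
  rw [hL'] at h
  intro x
  have hx : x ∈ cyclicSubspace (Set.range fun f : F => hL.gnsExtension ω (ξ f)) ω.gnsVector :=
    h ▸ Submodule.mem_top
  exact closure_mono (fun v hv => hspan v hv) hx

end Universal

end HostAlgebra

end
-- The main theorem
theorem theorem1p5
    {F : Type*} [CStarAlgebra F] [PartialOrder F] [StarOrderedRing F]
    {E : Type*} [CStarAlgebra E] [PartialOrder E] [StarOrderedRing E]
    {L : Type*} [NonUnitalCStarAlgebra L] [PartialOrder L] [StarOrderedRing L]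
    (S₀ : Set (State F)) (ι : L →⋆ₙₐ[ℂ] E) (ξ : F →⋆ₐ[ℂ] E)
    (hL : IsIdealHost S₀ ι ξ) :
    -- `[π(L)Ω] = [π(F)Ω]` for every representation `π` of `E` and `Ω` in the essential subspace
    (∀ (H : Type*) [NormedAddCommGroup H] [InnerProductSpace ℂ H] [CompleteSpace H]
        (π : E →⋆ₙₐ[ℂ] (H →L[ℂ] H)) (Ω : H),
        Ω ∈ essentialSubspace (Set.range fun l : L => π (ι l)) →
          cyclicSubspace (Set.range fun l : L => π (ι l)) Ω =
            cyclicSubspace (Set.range fun f : F => π (ξ f)) Ω) ∧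
    -- the universal representation of `L` extends uniquely to `E` on the same space
    (∃! ρ : E →⋆ₙₐ[ℂ] (UniversalSpace L →L[ℂ] UniversalSpace L),
        ∀ l : L, ρ (ι l) = universalRep L l) ∧
    -- and for this extension `ρ`
    (∀ ρ : E →⋆ₙₐ[ℂ] (UniversalSpace L →L[ℂ] UniversalSpace L),
        (∀ l : L, ρ (ι l) = universalRep L l) →
        -- `π_L(F)'' = π_L(L)''`
        doubleCommutant (Set.range fun f : F => ρ (ξ f)) =
          doubleCommutant (Set.range (universalRep L)) ∧
        -- `π_L` restricted to `F` is unitarily equivalent to `π_{S₀}`, and the unitary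
        -- carries `π_L(L)''` onto `π_{S₀}(F)''`
        ∃ U : UniversalSpace L ≃ₗᵢ[ℂ] SumSpace S₀,
          (∀ (f : F) (x : UniversalSpace L), U (ρ (ξ f) x) = sumRep S₀ f (U x)) ∧
          U.toContinuousLinearEquiv.conjContinuousAlgEquiv ''
              doubleCommutant (Set.range (universalRep L)) =
            doubleCommutant (Set.range (sumRep S₀))) := by
  refine ⟨fun H _ _ _ π Ω hΩ => hL.cyclicSubspace_eq π hΩ,
    ⟨hL.universalExtension, hL.universalExtension_map, fun ρ hρ => hL.eq_universalExtension hρ⟩,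
    fun ρ hρ => ?_⟩
  have hcomm : doubleCommutant (Set.range fun f : F => ρ (ξ f)) =
      doubleCommutant (Set.range (universalRep L)) := by
    rw [doubleCommutant, hL.centralizer_eq ρ fun x hx => lp.ext (funext fun ω =>
      eq_zero_of_gns_apply_eq_zero _ fun l =>
        congrArg (fun y : UniversalSpace L => y ω) ((hρ l ▸ hx l : universalRep L l x = 0)))]
    simp only [hρ]
    rfl
  refine ⟨hcomm, ?_⟩
  have hW : ∀ φ : S₀, ∃ W : ((hL.thetaEquiv.symm φ).toPositive.GNS) ≃ₗᵢ[ℂ] φ.1.toPositive.GNS,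
      ∀ f x, W (hL.gnsExtension (hL.thetaEquiv.symm φ) (ξ f) x) =
        φ.1.toPositive.gnsNonUnitalStarAlgHom f (W x) := by
    intro φ
    -- Writing `φ = θ(ω)` first lets the inverse of `θ` cancel in the types of the GNS spaces.
    obtain ⟨ω, rfl⟩ := hL.thetaEquiv.surjective φ
    rw [Equiv.symm_apply_apply]
    exact hL.exists_unitary_theta ω
  choose W hW using hW
  obtain ⟨U, hU⟩ := exists_lp_unitary
    (H := fun ω : (Set.univ : Set (State L)) => ω.1.toPositive.GNS)
    (K := fun φ : S₀ => φ.1.toPositive.GNS)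
    (hL.thetaEquiv.symm.trans (Equiv.Set.univ (State L)).symm) W
  have hint : ∀ (f : F) (x : UniversalSpace L), U (ρ (ξ f) x) = sumRep S₀ f (U x) := by
    intro f x
    rw [hL.eq_universalExtension hρ]
    refine lp.ext (funext fun φ => ?_)
    refine (hU _ φ).trans ((hW φ f _).trans ?_)
    exact congrArg (φ.1.toPositive.gnsNonUnitalStarAlgHom f) (hU x φ).symm
  refine ⟨U, hint, ?_⟩
  rw [← hcomm, image_doubleCommutant, ← Set.range_comp]
  refine congrArg doubleCommutant (congrArg Set.range (funext fun f =>
    ContinuousLinearMap.ext fun y => ?_))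
  exact (hint f _).trans (congrArg _ (U.apply_symm_apply y))
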